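/- Let $p\ge 0$, let $V$ be a known symmetric positive definite $p\times p$ matrix, and let $\mathcal C=\{\theta\in\mathbb R^p: a_1^T\theta\ge 0,\dots,a_k^T\theta\ge 0\}$ be a polyhedral cone. Equip $\mathbb R^p$ with the inner product $\langle x,y\rangle_V=x^TV^{-1}y$ and the norm $\|x\|_V^2=x^TV^{-1}x$. For $y\in\mathbb R^p$ let $$LR(y)=\min_{\theta\in\mathcal C}(y-\theta)^TV^{-1}(y-\theta)$$ be the likelihood ratio statistic for $H_1:\mu\in\mathcal C$ against $\mu\notin\mathcal C$. Let $\mathcal C^o=\{x\in\mathbb R^p:\langle x,\theta\rangle_V\le 0\ \text{for all }\theta\in\mathcal C\}$ be the polar cone, and let $\Pi_V(y|\mathcal C^o)$ be the projection of $y$ on $\mathcal C^o$ with respect to $\|\cdot\|_V$. Let $F_1,\dots,F_K$ be the faces of $\mathcal C^o$, whose relative interiors $\mathrm{ri}(F_1),\dots,\mathrm{ri}(F_K)$ partition $\mathcal C^o$, and let $r_i$ be the rank of the projection onto $\mathrm{span}(F_i)$, that is, $r_i=\dim\mathrm{span}(F_i)$. For $0<\alpha<1$ let $q_{\chi^2(r)}(1-\alpha)$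 be the $(1-\alpha)$-quantile of the chi-square distribution with $r$ degrees of freedom (the point mass at $0$ if $r=0$), and put $$q(y)=\sum_{i=1}^K \mathbf 1\{\Pi_V(y|\mathcal C^o)\in \mathrm{ri}(F_i)\}\,q_{\chi^2(r_i)}(1-\alpha).$$ Then $R=\{y: LR(y)>q(y)\}$ is a Borel set, and it is the rejection region of a test of $H_1$ of level $\alpha$: for every $\mu\in\mathcal C$ and every random vector $Y\sim\mathcal N_p(\mu,V)$, $$\mathbb P(LR(Y)>q(Y))\le\alpha .$$ Moreover, for every such $\mu$ and $Y$, $$\mathbb P(LR(Y)>q(Y))\le\bigl(1-\mathbb P(Y\in\mathcal C)\bigr)\,\alpha .$$ -/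

import Mathlib

open MeasureTheory ProbabilityTheory

noncomputable section

namespace TypeBTest

/-- A polyhedral cone in `ℝ^p`: the solution set of finitely many homogeneous linear
inequalities `a₁ᵀ θ ≥ 0, …, a_kᵀ θ ≥ 0`, where the `a_j` are the rows of `A`. -/
def IsPolyhedralCone {p : ℕ} (C : Set (EuclideanSpace ℝ (Fin p))) : Prop :=
  ∃ (k : ℕ) (A : Matrix (Fin k) (Fin p) ℝ), C = {θ | ∀ j, 0 ≤ (A.mulVec θ.ofLp) j}

/-- The inner product `xᵀ V⁻¹ y`. -/
def innerV {p : ℕ} (V : Matrix (Fin p) (Fin p) ℝ) (x y : EuclideanSpace ℝ (Fin p)) : ℝ :=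
  x.ofLp ⬝ᵥ V⁻¹.mulVec y.ofLp

/-- The squared norm `‖x‖²_V = xᵀ V⁻¹ x`. -/
def normSqV {p : ℕ} (V : Matrix (Fin p) (Fin p) ℝ) (x : EuclideanSpace ℝ (Fin p)) : ℝ :=
  innerV V x x

/-- The likelihood ratio statistic `min_{θ ∈ C} (y - θ)ᵀ V⁻¹ (y - θ)`. -/
def LR {p : ℕ} (V : Matrix (Fin p) (Fin p) ℝ) (C : Set (EuclideanSpace ℝ (Fin p)))
    (y : EuclideanSpace ℝ (Fin p)) : ℝ :=
  sInf ((fun θ => normSqV V (y - θ)) '' C)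

/-- The polar cone `{x | xᵀ V⁻¹ θ ≤ 0 for all θ ∈ C}` with respect to the inner product
`xᵀ V⁻¹ y`. -/
def polarCone {p : ℕ} (V : Matrix (Fin p) (Fin p) ℝ) (C : Set (EuclideanSpace ℝ (Fin p))) :
    PointedCone ℝ (EuclideanSpace ℝ (Fin p)) where
  carrier := {x | ∀ θ ∈ C, innerV V x θ ≤ 0}
  zero_mem' := by
    intro θ _
    simp [innerV]
  add_mem' := by
    intro x y hx hy θ hθ
    have h : innerV V (x + y) θ = innerV V x θ + innerV V y θ := by
      simp [innerV, add_dotProduct]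
    rw [h]
    exact add_nonpos (hx θ hθ) (hy θ hθ)
  smul_mem' := by
    intro c x hx θ hθ
    have h : innerV V (c • x) θ = (c : ℝ) * innerV V x θ := by
      rw [← Nonneg.coe_smul, innerV, innerV, WithLp.ofLp_smul, smul_dotProduct, smul_eq_mul]
    rw [h]
    exact mul_nonpos_of_nonneg_of_nonpos c.2 (hx θ hθ)

/-- `z` is a point of `K` nearest to `y` in the norm `‖·‖_V`. -/
def IsProjV {p : ℕ} (V : Matrix (Fin p) (Fin p) ℝ) (K : Set (EuclideanSpace ℝ (Fin p)))
    (y z : EuclideanSpace ℝ (Fin p)) : Prop :=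
  z ∈ K ∧ ∀ w ∈ K, normSqV V (y - z) ≤ normSqV V (y - w)

/-- The projection `Π_V(y | K)`: the point of `K` nearest to `y` in the norm `‖·‖_V`
(it exists and is unique when `K` is nonempty, closed and convex and `V` is positive
definite). -/
def projV {p : ℕ} (V : Matrix (Fin p) (Fin p) ℝ) (K : Set (EuclideanSpace ℝ (Fin p)))
    (y : EuclideanSpace ℝ (Fin p)) : EuclideanSpace ℝ (Fin p) :=
  Classical.epsilon (IsProjV V K y)

/-- The chi-square distribution with `r` degrees of freedom: the law of the sum of the squares
of `r` independent standard normal variables (the point mass at `0` when `r = 0`). -/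
def chiSq (r : ℕ) : Measure ℝ :=
  (Measure.pi (fun _ : Fin r => gaussianReal 0 1)).map (fun x => ∑ i, x i ^ 2)

/-- The quantile of order `β` of the chi-square distribution with `r` degrees of freedom. -/
def chiSqQuantile (r : ℕ) (β : ℝ) : ℝ :=
  sInf {x : ℝ | β ≤ (chiSq r).real (Set.Iic x)}

/-- The rank of the projection onto the linear span of `F`, that is, the dimension of the
span. -/
def spanRank {p : ℕ} (F : PointedCone ℝ (EuclideanSpace ℝ (Fin p))) : ℕ :=
  Module.finrank ℝ (Submodule.span ℝ (F : Set (EuclideanSpace ℝ (Fin p))))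

/-- The data-dependent critical value
`∑_F 1{Π_V(y | Cᵒ) ∈ ri F} · (quantile of order 1 - α of χ²(rank of F))`,
the sum being over the faces `F` of the polar cone `Cᵒ`. Relative interiors of distinct faces
are disjoint, so that at most one term does not vanish. -/
def critValue {p : ℕ} (V : Matrix (Fin p) (Fin p) ℝ) (C : Set (EuclideanSpace ℝ (Fin p)))
    (α : ℝ) (y : EuclideanSpace ℝ (Fin p)) : ℝ :=
  ∑ᶠ F : {F : PointedCone ℝ (EuclideanSpace ℝ (Fin p)) // F.IsFaceOf (polarCone V C)},
    (intrinsicInterior ℝ (F.1 : Set (EuclideanSpace ℝ (Fin p)))).indicator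
      (fun _ => chiSqQuantile (spanRank F.1) (1 - α)) (projV V (polarCone V C) y)

/-- The rejection region `{y | LR(y) > q(y)}` of the test. -/
def rejectionRegion {p : ℕ} (V : Matrix (Fin p) (Fin p) ℝ)
    (C : Set (EuclideanSpace ℝ (Fin p))) (α : ℝ) : Set (EuclideanSpace ℝ (Fin p)) :=
  {y | critValue V C α y < LR V C y}

end TypeBTest

end

namespace TypeBTest

open scoped RealInnerProductSpace

/-! The square root of `V` is an isometry from the Euclidean norm to `‖·‖_V`, so one may take `V =
1`, with `Y = m + Z`, `Z` standard Gaussian, `m ∈ D` (the preimage of `C`) and `K` the polar of `D`.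
Moreau's theorem writes `v = z + w` with `z ∈ K`, `w ∈ D`, `z ⊥ w`; then `z` is the projection of
`v` on `K` and `LR = ‖z‖²`.

The point `z` lies in the relative interior of exactly one face `F`. Since `w` is polar to `F` and
orthogonal to `z`, it is orthogonal to `L = span F`. The cell of `F` is thus a product event: the
component of `v` in `L` is in `ri F`, the one in `Lᗮ` is in `D` (`mem_faceCell_of_moreau`). The two
components are independent.

In `L`, norm and direction of a centred Gaussian are independent, so conditioning on the cone `ri F`
leaves the chi-square tail unchanged. The shift multiplies the density by `exp(⟪u, m⟫ - const)`,
which does not increase along rays of `F` because `⟪u, m⟫ ≤ 0`; hence the tail only gets lighter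
(`map_const_add_stdGaussian_inter_norm_le`).

Quantiles are nonnegative, so rejection forces `z ≠ 0`. The parts of the cells with `z ≠ 0` are
disjoint and miss `D`; summing the bounds over the finitely many faces gives `(1 - P(D)) α`. -/

/-! ### Finitely generated cones: closedness, Farkas' lemma, finiteness of faces -/

/-- Conic Carathéodory: independent generators give an injective linear image of a closed orthant;
dependent ones allow a generator to be dropped, so the cone is a finite union of cones with fewer
generators. -/
theorem isClosed_nonneg_combinations {ι E : Type*} [NormedAddCommGroup E] [NormedSpace ℝ E]
    [FiniteDimensional ℝ E] (v : ι → E) (s : Finset ι) :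
    IsClosed {x : E | ∃ c : ι → ℝ, (∀ i, 0 ≤ c i) ∧ ∑ i ∈ s, c i • v i = x} := by
  classical
  induction s using Finset.strongInduction with
  | H s ih =>
  by_cases hli : LinearIndepOn ℝ v (s : Set ι)
  · set f : (s → ℝ) →ₗ[ℝ] E := Fintype.linearCombination ℝ (fun i : s => v i) with hf
    have hinj : Function.Injective f := by
      have := linearIndependent_iff_injective_fintypeLinearCombination.1 (show LinearIndependent ℝ (fun i : s => v i) from hli)
      exact this
    have hcl : IsClosed (f '' {c | ∀ i, 0 ≤ c i}) := by
      refine (LinearMap.isClosedEmbedding_of_injective (LinearMap.ker_eq_bot.2 hinj)).isClosedMap _ ?_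
      simp only [Set.ofPred_forall]
      exact isClosed_iInter fun i => isClosed_le continuous_const (continuous_apply i)
    convert hcl using 1
    ext x
    simp only [Set.mem_ofPred_eq, Set.mem_image]
    constructor
    · rintro ⟨c, hc, rfl⟩
      refine ⟨fun i => c i, fun i => hc i, ?_⟩
      simp only [hf, Fintype.linearCombination_apply]
      exact Finset.sum_coe_sort s fun i => c i • v i
    · rintro ⟨c, hc, rfl⟩
      refine ⟨fun i => if h : i ∈ s then c ⟨i, h⟩ else 0, fun i => ?_, ?_⟩
      · dsimp only
        split_ifs
        · exact hc _
        · exact le_rfl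
      · simp only [hf, Fintype.linearCombination_apply]
        rw [← Finset.sum_coe_sort s]
        exact Finset.sum_congr rfl fun i _ => by simp
  · obtain ⟨d, hd, j, hj, hdj⟩ : ∃ d : ι → ℝ, ∑ i ∈ s, d i • v i = 0 ∧ ∃ i ∈ s, 0 < d i := by
      rw [linearIndepOn_finset_iff] at hli
      push Not at hli
      obtain ⟨d, hd, i, hi, hdi⟩ := hli
      rcases lt_or_gt_of_ne hdi with h | h
      · exact ⟨-d, by simp [hd], i, hi, by simpa using h⟩
      · exact ⟨d, hd, i, hi, h⟩
    have key : {x : E | ∃ c : ι → ℝ, (∀ i, 0 ≤ c i) ∧ ∑ i ∈ s, c i • v i = x} =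
        ⋃ i ∈ s, {x : E | ∃ c : ι → ℝ, (∀ i, 0 ≤ c i) ∧ ∑ l ∈ s.erase i, c l • v l = x} := by
      ext x
      simp only [Set.mem_ofPred_eq, Set.mem_iUnion, exists_prop]
      constructor
      · rintro ⟨c, hc, rfl⟩
        -- The minimal ratio `c i / d i` is the largest `r` for which `c - r • d` stays nonnegative;
        -- it kills the coefficient at `i`.
        obtain ⟨i, hi, hmin⟩ := (s.filter (fun i => 0 < d i)).exists_min_image
          (fun i => c i / d i) ⟨j, by simp [hj, hdj]⟩
        simp only [Finset.mem_filter] at hi hmin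
        set r := c i / d i with hr
        have hr0 : 0 ≤ r := div_nonneg (hc i) hi.2.le
        have hnn : ∀ l ∈ s, 0 ≤ c l - r * d l := by
          intro l hl
          rcases le_or_gt (d l) 0 with h | h
          · nlinarith [hc l]
          · have := hmin l ⟨hl, h⟩
            rw [le_div_iff₀ h] at this
            linarith
        refine ⟨i, hi.1, fun l => if l ∈ s then c l - r * d l else 0, fun l => ?_, ?_⟩
        · dsimp only
          split_ifs with h
          · exact hnn l h
          · exact le_rfl
        · have hi0 : c i - r * d i = 0 := by rw [hr, div_mul_cancel₀ _ hi.2.ne', sub_self]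
          have h1 : ∑ l ∈ s.erase i, (if l ∈ s then c l - r * d l else 0) • v l =
              ∑ l ∈ s.erase i, (c l - r * d l) • v l :=
            Finset.sum_congr rfl fun l hl => by rw [if_pos (Finset.mem_of_mem_erase hl)]
          rw [h1]
          have h2 := Finset.add_sum_erase s (fun l => (c l - r * d l) • v l) hi.1
          simp only [hi0, zero_smul, zero_add] at h2
          rw [h2]
          simp only [sub_smul, Finset.sum_sub_distrib, mul_smul]
          rw [← Finset.smul_sum, hd, smul_zero, sub_zero]
      · rintro ⟨i, hi, c, hc, rfl⟩
        refine ⟨Function.update c i 0, fun l => ?_, ?_⟩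
        · rcases eq_or_ne l i with rfl | h
          · simp
          · simpa [h] using hc l
        · rw [← Finset.add_sum_erase s _ hi]
          simp only [Function.update_self, zero_smul, zero_add]
          exact Finset.sum_congr rfl fun l hl => by
            rw [Function.update_of_ne (Finset.ne_of_mem_erase hl)]
    rw [key]
    exact s.finite_toSet.isClosed_biUnion fun i hi => ih _ (Finset.erase_ssubset hi)

/-- Farkas' lemma: a point outside the closed cone would be separated from it by a hyperplane. -/
theorem exists_nonneg_combination_of_forall_inner_nonneg {ι E : Type*} [Fintype ι]
    [NormedAddCommGroup E] [InnerProductSpace ℝ E] [FiniteDimensional ℝ E] (v : ι → E) (x : E)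
    (h : ∀ y, (∀ i, 0 ≤ ⟪v i, y⟫) → 0 ≤ ⟪x, y⟫) :
    ∃ c : ι → ℝ, (∀ i, 0 ≤ c i) ∧ ∑ i, c i • v i = x := by
  classical
  set S : Set E := {x : E | ∃ c : ι → ℝ, (∀ i, 0 ≤ c i) ∧ ∑ i, c i • v i = x} with hS
  let P : ProperCone ℝ E :=
    { carrier := S
      zero_mem' := ⟨0, fun _ => le_rfl, by simp⟩
      add_mem' := by
        rintro _ _ ⟨c, hc, rfl⟩ ⟨d, hd, rfl⟩
        exact ⟨c + d, fun i => add_nonneg (hc i) (hd i), by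
          simp [add_smul, Finset.sum_add_distrib]⟩
      smul_mem' := by
        rintro r _ ⟨c, hc, rfl⟩
        exact ⟨fun i => (r : ℝ) * c i, fun i => mul_nonneg r.2 (hc i), by
          simp [mul_smul, Finset.smul_sum]⟩
      isClosed' := isClosed_nonneg_combinations v Finset.univ }
  by_contra hx
  obtain ⟨f, hf, hfx⟩ := ProperCone.hyperplane_separation_point P (x₀ := x) hx
  obtain ⟨y, rfl⟩ := (InnerProductSpace.toDual ℝ E).surjective f
  refine absurd (h y fun i => ?_) (not_le.2 ?_)
  · rw [real_inner_comm]
    refine hf (v i) ⟨Pi.single i 1, fun j => ?_, ?_⟩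
    · by_cases hij : j = i
      · subst hij; simp
      · simp [hij]
    · rw [Finset.sum_eq_single i] <;> simp +contextual
  · rw [real_inner_comm]
    exact hfx

/-- A pointed cone that consists of the nonnegative combinations of finitely many vectors has
finitely many faces. -/
theorem finite_isFaceOf {ι E : Type*} [Fintype ι] [AddCommGroup E] [Module ℝ E]
    (K : PointedCone ℝ E) (v : ι → E) (hv : ∀ i, v i ∈ K)
    (hK : ∀ x ∈ K, ∃ c : ι → ℝ, (∀ i, 0 ≤ c i) ∧ ∑ i, c i • v i = x) :
    Finite {F : PointedCone ℝ E // F.IsFaceOf K} := by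
  classical
  -- A face is determined by the generators it contains: a combination lies in a face only if every
  -- generator with positive coefficient does.
  have hle : ∀ F G : PointedCone ℝ E, F.IsFaceOf K → G.IsFaceOf K →
      {i | v i ∈ F} = {i | v i ∈ G} → F ≤ G := by
    intro F G hF hG hFG x hx
    obtain ⟨c, hc, rfl⟩ := hK x (hF.le hx)
    refine G.sum_mem fun i _ => ?_
    rcases (hc i).eq_or_lt with h | h
    · simp [← h]
    · exact G.smul_mem (hc i) (hFG.subset (hF.mem_of_sum_smul_mem hv hc hx i h))
  refine Finite.of_injective (fun F : {F : PointedCone ℝ E // F.IsFaceOf K} => {i | v i ∈ F.1}) ?_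
  intro F G h
  exact Subtype.ext (le_antisymm (hle _ _ F.2 G.2 h) (hle _ _ G.2 F.2 h.symm))

/-! ### Relative interiors of faces -/

/-- The relative interior of a pointed cone in algebraic terms. -/
theorem mem_intrinsicInterior_pointedCone_iff {E : Type*} [NormedAddCommGroup E]
    [NormedSpace ℝ E] [FiniteDimensional ℝ E] {F : PointedCone ℝ E} {x : E} :
    x ∈ intrinsicInterior ℝ (F : Set E) ↔ x ∈ F ∧ ∀ y ∈ F, ∃ ε : ℝ, 0 < ε ∧ x - ε • y ∈ F := by
  have h0 : (0 : E) ∈ affineSpan ℝ (F : Set E) := subset_affineSpan _ _ F.zero_mem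
  constructor
  · intro hx
    refine ⟨intrinsicInterior_subset hx, fun y hy => ?_⟩
    obtain ⟨u, hu, rfl⟩ := mem_intrinsicInterior.1 hx
    have hy' : y ∈ affineSpan ℝ (F : Set E) := subset_affineSpan _ _ hy
    have hmem : ∀ t : ℝ, (u : E) - t • y ∈ affineSpan ℝ (F : Set E) := fun t => by
      have := AffineSubspace.smul_vsub_vadd_mem _ t h0 hy' u.2
      simpa [sub_eq_neg_add] using this
    have hcont : Continuous fun t : ℝ => (⟨(u : E) - t • y, hmem t⟩ : affineSpan ℝ (F : Set E)) :=
      Continuous.subtype_mk (by fun_prop) _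
    have hnhds := hcont.continuousAt (x := 0) |>.preimage_mem_nhds
      (t := ((↑) ⁻¹' (F : Set E) : Set (affineSpan ℝ (F : Set E))))
      (by simpa using mem_interior_iff_mem_nhds.1 hu)
    obtain ⟨ε, hε, hball⟩ := Metric.mem_nhds_iff.1 hnhds
    refine ⟨ε / 2, by positivity, ?_⟩
    have := @hball (ε / 2) (by simp [abs_of_pos hε]; linarith)
    simpa using this
  · rintro ⟨hxF, hx⟩
    obtain ⟨x₀, hx₀⟩ := Set.Nonempty.intrinsicInterior F.convex ⟨0, F.zero_mem⟩
    obtain ⟨ε, hε, hdiff⟩ := hx x₀ (intrinsicInterior_subset hx₀)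
    obtain ⟨u, hu, rfl⟩ := mem_intrinsicInterior.1 hx₀
    have hd' := subset_affineSpan ℝ (F : Set E) hdiff
    have hmem : ∀ a : affineSpan ℝ (F : Set E),
        ε⁻¹ • ((a : E) - (x - ε • (u : E))) ∈ affineSpan ℝ (F : Set E) := fun a => by
      have := AffineSubspace.smul_vsub_vadd_mem _ ε⁻¹ a.2 hd' h0
      simpa using this
    -- With `u` in the relative interior and `x - ε • u ∈ F`, each `a` equals `ε • ψ a + (x - ε •
    -- u)`. So `ψ` pulls a neighbourhood of `u` inside `F` back to a neighbourhood of `x` inside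
    -- `F`.
    let ψ : affineSpan ℝ (F : Set E) → affineSpan ℝ (F : Set E) := fun a => ⟨_, hmem a⟩
    have hcont : Continuous ψ := Continuous.subtype_mk (by fun_prop) _
    refine mem_intrinsicInterior.2 ⟨⟨x, subset_affineSpan _ _ hxF⟩, ?_, rfl⟩
    refine mem_interior.2 ⟨ψ ⁻¹' interior ((↑) ⁻¹' (F : Set E)), fun a ha => ?_,
      isOpen_interior.preimage hcont, ?_⟩
    · have h1 : ε⁻¹ • ((a : E) - (x - ε • (u : E))) ∈ F :=
        (interior_subset (Set.mem_preimage.1 ha) : ψ a ∈ (↑) ⁻¹' (F : Set E))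
      have h2 := F.add_mem (F.smul_mem hε.le h1) hdiff
      rw [smul_inv_smul₀ hε.ne'] at h2
      simpa using h2
    · have : ψ ⟨x, subset_affineSpan _ _ hxF⟩ = u := by
        apply Subtype.ext
        simp [ψ, inv_smul_smul₀ hε.ne']
      rw [Set.mem_preimage, this]
      exact hu

theorem smul_mem_intrinsicInterior_pointedCone {E : Type*} [NormedAddCommGroup E]
    [NormedSpace ℝ E] [FiniteDimensional ℝ E] {F : PointedCone ℝ E} {x : E} {c : ℝ} (hc : 0 < c)
    (hx : x ∈ intrinsicInterior ℝ (F : Set E)) : c • x ∈ intrinsicInterior ℝ (F : Set E) := by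
  rw [mem_intrinsicInterior_pointedCone_iff] at hx ⊢
  refine ⟨F.smul_mem hc.le hx.1, fun y hy => ?_⟩
  obtain ⟨ε, hε, h⟩ := hx.2 y hy
  exact ⟨c * ε, mul_pos hc hε, by simpa [smul_sub, mul_smul] using F.smul_mem hc.le h⟩

theorem measurableSet_intrinsicInterior {E : Type*} [NormedAddCommGroup E] [NormedSpace ℝ E]
    [FiniteDimensional ℝ E] [MeasurableSpace E] [BorelSpace E] (s : Set E) :
    MeasurableSet (intrinsicInterior ℝ s) :=
  (MeasurableEmbedding.subtype_coe
    (AffineSubspace.closed_of_finiteDimensional (affineSpan ℝ s)).measurableSet).measurableSet_image.2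
    isOpen_interior.measurableSet

/-- For `x ∈ F`, the splitting `z = ε • x + (z - ε • x)` inside `F` and the face property of `G` put
`x` in `G`; then exchange the roles. -/
theorem eq_of_mem_intrinsicInterior_of_isFaceOf {E : Type*} [NormedAddCommGroup E]
    [NormedSpace ℝ E] [FiniteDimensional ℝ E] {K F G : PointedCone ℝ E} (hF : F.IsFaceOf K)
    (hG : G.IsFaceOf K) {z : E} (hzF : z ∈ intrinsicInterior ℝ (F : Set E))
    (hzG : z ∈ intrinsicInterior ℝ (G : Set E)) : F = G := by
  have hle : ∀ F G : PointedCone ℝ E, F.IsFaceOf K → G.IsFaceOf K →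
      z ∈ intrinsicInterior ℝ (F : Set E) → z ∈ G → F ≤ G := by
    intro F G hF hG hzF hzG x hx
    obtain ⟨ε, hε, h⟩ := (mem_intrinsicInterior_pointedCone_iff.1 hzF).2 x hx
    exact hG.mem_of_smul_add_mem (hF.le hx) (hF.le h) hε (by simpa using hzG)
  exact le_antisymm (hle F G hF hG hzF (intrinsicInterior_subset hzG))
    (hle G F hG hF hzG (intrinsicInterior_subset hzF))

/-- The relative interiors of the faces cover the cone. -/
theorem exists_isFaceOf_mem_intrinsicInterior {E : Type*} [NormedAddCommGroup E]
    [NormedSpace ℝ E] [FiniteDimensional ℝ E] (K : PointedCone ℝ E) {z : E} (hz : z ∈ K) :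
    ∃ F : PointedCone ℝ E, F.IsFaceOf K ∧ z ∈ intrinsicInterior ℝ (F : Set E) := by
  -- The minimal face of `z`: all directions of `K` that can be subtracted from `z` a little without
  -- leaving `K`.
  let F : PointedCone ℝ E :=
    { carrier := {x | x ∈ K ∧ ∃ ε : ℝ, 0 < ε ∧ z - ε • x ∈ K}
      zero_mem' := ⟨K.zero_mem, 1, one_pos, by simpa using hz⟩
      add_mem' := by
        rintro x y ⟨hx, ε, hε, hzx⟩ ⟨hy, δ, hδ, hzy⟩
        refine ⟨K.add_mem hx hy, ε * δ / (ε + δ), by positivity, ?_⟩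
        have h := K.add_mem
          (K.smul_mem (show (0 : ℝ) ≤ δ / (ε + δ) by positivity) hzx)
          (K.smul_mem (show (0 : ℝ) ≤ ε / (ε + δ) by positivity) hzy)
        convert h using 1
        match_scalars <;> field_simp
        ring
      smul_mem' := by
        rintro ⟨c, hc⟩ x ⟨hx, ε, hε, hzx⟩
        refine ⟨K.smul_mem hc hx, ?_⟩
        change ∃ ε : ℝ, 0 < ε ∧ z - ε • (c • x) ∈ K
        rcases hc.eq_or_lt with rfl | hc
        · exact ⟨1, one_pos, by simpa using hz⟩
        · exact ⟨ε / c, by positivity, by rwa [smul_smul, div_mul_cancel₀ _ hc.ne']⟩ }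
  refine ⟨F, ⟨fun x hx => hx.1, ?_⟩, mem_intrinsicInterior_pointedCone_iff.2
    ⟨⟨hz, 1, one_pos, by simp⟩, ?_⟩⟩
  · rintro x y a hx hy ha ⟨-, ε, hε, h⟩
    refine ⟨hx, ε * a, by positivity, ?_⟩
    have := K.add_mem h (K.smul_mem hε.le hy)
    convert this using 1
    module
  · rintro x ⟨hx, ε, hε, h⟩
    exact ⟨ε, hε, h, 1, one_pos, by simpa using K.smul_mem hε.le hx⟩

/-! ### Moreau decomposition and the cells of the faces -/

section Moreau

variable {E : Type*} [NormedAddCommGroup E] [InnerProductSpace ℝ E]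

/-- Moreau decomposition of a point with respect to a polyhedral cone `D` and its polar `K`. -/
theorem exists_moreau_decomposition [FiniteDimensional ℝ E] {ι : Type*} {b : ι → E}
    {D : Set E} (hD : D = {v | ∀ j, 0 ≤ ⟪b j, v⟫}) {K : PointedCone ℝ E}
    (hK : ∀ x, x ∈ K ↔ ∀ v ∈ D, ⟪x, v⟫ ≤ 0) (v : E) :
    ∃ z ∈ K, v - z ∈ D ∧ ⟪z, v - z⟫ = 0 := by
  have hcl : IsClosed (K : Set E) := by
    have : (K : Set E) = ⋂ v ∈ D, {x | ⟪x, v⟫ ≤ 0} := by ext x; simp [hK]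
    rw [this]
    exact isClosed_biInter fun v _ => isClosed_le (by fun_prop) continuous_const
  obtain ⟨z, hz, hmin⟩ := exists_norm_eq_iInf_of_complete_convex ⟨0, K.zero_mem⟩
    hcl.isComplete K.convex v
  rw [norm_eq_iInf_iff_real_inner_le_zero K.convex hz] at hmin
  have h1 : ∀ x ∈ K, ⟪v - z, x⟫ ≤ 0 := fun x hx => by
    simpa using hmin (z + x) (K.add_mem hz hx)
  have h2 : 0 ≤ ⟪v - z, z⟫ := by simpa using hmin 0 K.zero_mem
  refine ⟨z, hz, ?_, ?_⟩
  · rw [hD]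
    intro j
    -- Each `-b j` is in the polar cone, so testing against it recovers the inequality of `D`
    -- indexed by `j`.
    have := h1 (-b j) ((hK _).2 fun u hu => by
      rw [hD] at hu
      simpa using hu j)
    rw [real_inner_comm]
    simpa using this
  · rw [real_inner_comm]
    exact le_antisymm (h1 z hz) h2

variable {D : Set E} {K : PointedCone ℝ E}

theorem norm_sub_sq_ge_of_moreau (hK : ∀ x, x ∈ K ↔ ∀ v ∈ D, ⟪x, v⟫ ≤ 0) {v z : E} (hz : z ∈ K)
    (h0 : ⟪z, v - z⟫ = 0) {θ : E} (hθ : θ ∈ D) : ‖z‖ ^ 2 ≤ ‖v - θ‖ ^ 2 := by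
  have h1 := (hK z).1 hz θ hθ
  have h2 : v - θ = z + ((v - z) - θ) := by abel
  rw [h2, norm_add_sq_real, inner_sub_right, h0]
  nlinarith [sq_nonneg ‖v - z - θ‖]

/-- The extra term `‖z - x‖ ^ 2` makes `z` the only nearest point of `K`. -/
theorem norm_sub_sq_le_of_moreau (hK : ∀ x, x ∈ K ↔ ∀ v ∈ D, ⟪x, v⟫ ≤ 0) {v z : E}
    (hw : v - z ∈ D) (h0 : ⟪z, v - z⟫ = 0) {x : E} (hx : x ∈ K) :
    ‖v - z‖ ^ 2 + ‖z - x‖ ^ 2 ≤ ‖v - x‖ ^ 2 := by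
  have h1 := (hK x).1 hx _ hw
  have h2 : v - x = (v - z) + (z - x) := by abel
  rw [h2, norm_add_sq_real, inner_sub_right, real_inner_comm, h0, real_inner_comm]
  linarith

theorem eq_of_moreau (hK : ∀ x, x ∈ K ↔ ∀ v ∈ D, ⟪x, v⟫ ≤ 0) {v z x : E} (hz : z ∈ K)
    (hw : v - z ∈ D) (h0 : ⟪z, v - z⟫ = 0) (hx : x ∈ K) (hwx : v - x ∈ D)
    (h0x : ⟪x, v - x⟫ = 0) : z = x := by
  have h1 := norm_sub_sq_le_of_moreau hK hw h0 hx
  have h2 := norm_sub_sq_le_of_moreau hK hwx h0x hz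
  have h3 : ‖z - x‖ ^ 2 ≤ 0 := by nlinarith [sq_nonneg ‖x - z‖]
  exact sub_eq_zero.1 (norm_eq_zero.1 (pow_eq_zero_iff two_ne_zero |>.1
    (le_antisymm h3 (sq_nonneg _))))

variable [FiniteDimensional ℝ E]

/-- For `x ∈ F`, polarity gives `⟪x, w⟫ ≤ 0`; applied to `z - ε • x ∈ F`, with `⟪z, w⟫ = 0`, it
gives the opposite sign. -/
theorem mem_orthogonal_span_of_mem_intrinsicInterior (hK : ∀ x, x ∈ K ↔ ∀ v ∈ D, ⟪x, v⟫ ≤ 0)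
    {F : PointedCone ℝ E} (hF : F ≤ K) {z w : E} (hz : z ∈ intrinsicInterior ℝ (F : Set E))
    (hw : w ∈ D) (h0 : ⟪z, w⟫ = 0) : w ∈ (Submodule.span ℝ (F : Set E))ᗮ := by
  rw [Submodule.mem_orthogonal]
  intro u hu
  induction hu using Submodule.span_induction with
  | mem x hx =>
    refine le_antisymm ((hK x).1 (hF hx) w hw) ?_
    obtain ⟨ε, hε, h⟩ := (mem_intrinsicInterior_pointedCone_iff.1 hz).2 x hx
    have := (hK _).1 (hF h) w hw
    rw [inner_sub_left, h0, inner_smul_left] at this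
    simp only [RCLike.conj_to_real] at this
    nlinarith
  | zero => simp
  | add x y _ _ hx hy => simp [inner_add_left, hx, hy]
  | smul a x _ hx => simp [inner_smul_left, hx]

/-- The set of the points whose projection onto the cone is in the relative interior of the
face `F`, in terms of the orthogonal projection onto the span of `F`. -/
def faceCell (D : Set E) (F : PointedCone ℝ E) : Set E :=
  {v | (Submodule.span ℝ (F : Set E)).starProjection v ∈ intrinsicInterior ℝ (F : Set E) ∧
    (Submodule.span ℝ (F : Set E))ᗮ.starProjection v ∈ D}

theorem starProjection_orthogonal_eq_sub (L : Submodule ℝ E) (v : E) :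
    Lᗮ.starProjection v = v - L.starProjection v := by
  rw [Submodule.starProjection_orthogonal_val]

theorem moreau_of_mem_faceCell {F : PointedCone ℝ E} {v : E} (hv : v ∈ faceCell D F) :
    v - (Submodule.span ℝ (F : Set E)).starProjection v ∈ D ∧
      ⟪(Submodule.span ℝ (F : Set E)).starProjection v,
        v - (Submodule.span ℝ (F : Set E)).starProjection v⟫ = 0 := by
  rw [← starProjection_orthogonal_eq_sub]
  exact ⟨hv.2, Submodule.inner_right_of_mem_orthogonal
    (Submodule.starProjection_apply_mem _ _) (Submodule.starProjection_apply_mem _ _)⟩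

theorem mem_faceCell_of_moreau (hK : ∀ x, x ∈ K ↔ ∀ v ∈ D, ⟪x, v⟫ ≤ 0)
    {F : PointedCone ℝ E} (hF : F ≤ K) {v z : E} (hz : z ∈ intrinsicInterior ℝ (F : Set E))
    (hw : v - z ∈ D) (h0 : ⟪z, v - z⟫ = 0) :
    v ∈ faceCell D F ∧ (Submodule.span ℝ (F : Set E)).starProjection v = z := by
  have h := mem_orthogonal_span_of_mem_intrinsicInterior hK hF hz hw h0
  have hzL : z ∈ Submodule.span ℝ (F : Set E) :=
    Submodule.subset_span (intrinsicInterior_subset hz)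
  have hp : (Submodule.span ℝ (F : Set E)).starProjection v = z :=
    Submodule.eq_starProjection_of_mem_orthogonal hzL h
  refine ⟨⟨by rwa [hp], ?_⟩, hp⟩
  rwa [starProjection_orthogonal_eq_sub, hp]

theorem starProjection_eq_of_mem_faceCell (hK : ∀ x, x ∈ K ↔ ∀ v ∈ D, ⟪x, v⟫ ≤ 0)
    {F : PointedCone ℝ E} (hF : F ≤ K) {v z : E} (hv : v ∈ faceCell D F) (hz : z ∈ K)
    (hw : v - z ∈ D) (h0 : ⟪z, v - z⟫ = 0) :
    (Submodule.span ℝ (F : Set E)).starProjection v = z :=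
  have h := moreau_of_mem_faceCell hv
  eq_of_moreau hK (hF (intrinsicInterior_subset hv.1)) h.1 h.2 hz hw h0

end Moreau

/-! ### Gaussian density, polar coordinates and the shifted tail bound -/

/-- The density of the standard Gaussian measure on a Euclidean space of dimension `d` at the
points of norm `s`. -/
noncomputable def gaussianDensity (d : ℕ) (s : ℝ) : ENNReal :=
  ENNReal.ofReal ((2 * Real.pi) ^ (-(d / 2 : ℝ)) * Real.exp (-(s ^ 2 / 2)))

@[fun_prop]
theorem measurable_gaussianDensity (d : ℕ) : Measurable (gaussianDensity d) := by
  unfold gaussianDensity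
  fun_prop

section Density

variable {E : Type*} [NormedAddCommGroup E] [InnerProductSpace ℝ E] [FiniteDimensional ℝ E]
  [MeasurableSpace E] [BorelSpace E]

theorem stdGaussian_eq_withDensity :
    stdGaussian E =
      (volume : Measure E).withDensity fun x => gaussianDensity (Module.finrank ℝ E) ‖x‖ := by
  have hint : Integrable (fun x : E =>
      (2 * Real.pi) ^ (-(Module.finrank ℝ E / 2 : ℝ)) * Real.exp (-(‖x‖ ^ 2 / 2))) := by
    refine Integrable.const_mul ?_ _
    have := (GaussianFourier.integrable_cexp_neg_mul_sq_norm_add (V := E) (b := 1 / 2)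
      (by norm_num) 0 0).norm
    refine this.congr (Filter.Eventually.of_forall fun x => ?_)
    have h : (-(1 / 2) * (‖x‖ : ℂ) ^ 2 + 0 * ((⟪(0 : E), x⟫ : ℝ) : ℂ)) =
        ((-(‖x‖ ^ 2 / 2) : ℝ) : ℂ) := by
      push_cast
      ring
    dsimp only
    rw [h, Complex.norm_exp, Complex.ofReal_re]
  have : IsFiniteMeasure ((volume : Measure E).withDensity
      fun x => gaussianDensity (Module.finrank ℝ E) ‖x‖) :=
    isFiniteMeasure_withDensity_ofReal hint.2
  refine Measure.ext_of_charFun ?_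
  ext t
  rw [charFun_stdGaussian, charFun_apply, integral_withDensity_eq_integral_toReal_smul
    (by fun_prop) (Filter.Eventually.of_forall fun x => by simp [gaussianDensity])]
  have h := GaussianFourier.integral_cexp_neg_mul_sq_norm_add (V := E) (b := 1 / 2)
      (by norm_num) Complex.I t
  have h2 : ∀ x : E, (gaussianDensity (Module.finrank ℝ E) ‖x‖).toReal •
      Complex.exp (⟪x, t⟫ * Complex.I) = (((2 * Real.pi) ^ (-(Module.finrank ℝ E / 2 : ℝ)) : ℝ) : ℂ) *
      Complex.exp (-(1 / 2) * ‖x‖ ^ 2 + Complex.I * ⟪t, x⟫) := by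
    intro x
    rw [gaussianDensity, ENNReal.toReal_ofReal (by positivity), Complex.exp_add, Complex.real_smul,
      Complex.ofReal_mul, Complex.ofReal_exp, real_inner_comm, mul_comm Complex.I, mul_assoc]
    congr 3
    push_cast
    ring_nf
  simp_rw [h2]
  rw [integral_const_mul, h]
  have h3 : (Real.pi / (1 / 2) : ℂ) ^ (Module.finrank ℝ E / 2 : ℂ) =
      (((2 * Real.pi) ^ ((Module.finrank ℝ E / 2 : ℝ)) : ℝ) : ℂ) := by
    rw [Complex.ofReal_cpow (by positivity)]
    push_cast
    congr 1
    ring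
  rw [h3, ← mul_assoc, ← Complex.ofReal_mul, ← Real.rpow_add (by positivity)]
  simp
  norm_num

/-- Integration in polar coordinates: a function of the norm and a function that is constant
on the open rays from the origin separate. -/
theorem lintegral_norm_mul_eq [Nontrivial E] {f : ℝ → ENNReal} (hf : Measurable f)
    {c : E → ENNReal} (hc : Measurable c) (hhom : ∀ r : ℝ, 0 < r → ∀ x, c (r • x) = c x) :
    ∫⁻ x, f ‖x‖ * c x = (∫⁻ u : Metric.sphere (0 : E) 1, c u ∂(volume : Measure E).toSphere) *
      ∫⁻ r : Set.Ioi (0 : ℝ), f r ∂Measure.volumeIoiPow (Module.finrank ℝ E - 1) := by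
  have hmp := (volume : Measure E).measurePreserving_homeomorphUnitSphereProd
  rw [← lintegral_prod_mul (by fun_prop) (by fun_prop),
    ← hmp.lintegral_comp (f := fun z : Metric.sphere (0 : E) 1 × Set.Ioi (0 : ℝ) =>
      c z.1 * f z.2) (by fun_prop)]
  calc ∫⁻ x, f ‖x‖ * c x = ∫⁻ x in {0}ᶜ, f ‖x‖ * c x := by rw [restrict_compl_singleton]
    _ = ∫⁻ x : ({0}ᶜ : Set E), f ‖(x : E)‖ * c x ∂(volume : Measure E).comap (↑) :=
      (lintegral_subtype_comap (measurableSet_singleton _).compl fun x : E => f ‖x‖ * c x).symm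
    _ = _ := by
      refine lintegral_congr fun x => ?_
      have hx : 0 < ‖(x : E)‖ := norm_pos_iff.2 x.2
      simp [hhom _ (inv_pos.2 hx), mul_comm]

theorem setLIntegral_norm_stdGaussian {B : Set ℝ} (hB : MeasurableSet B)
    {c : E → ENNReal} (hc : Measurable c) :
    ∫⁻ x in (‖·‖) ⁻¹' B, c x ∂stdGaussian E =
      ∫⁻ x : E, B.indicator (gaussianDensity (Module.finrank ℝ E)) ‖x‖ * c x := by
  rw [← lintegral_indicator (measurable_norm hB), stdGaussian_eq_withDensity,
    lintegral_withDensity_eq_lintegral_mul _ (by fun_prop)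
      (hc.indicator (measurable_norm hB))]
  refine lintegral_congr fun x => ?_
  by_cases hx : ‖x‖ ∈ B <;> simp [hx]

/-- The norm and the direction of a standard Gaussian vector are independent. -/
theorem setLIntegral_norm_stdGaussian_eq_mul [Nontrivial E] {B : Set ℝ} (hB : MeasurableSet B)
    {c : E → ENNReal} (hc : Measurable c) (hhom : ∀ r : ℝ, 0 < r → ∀ x, c (r • x) = c x) :
    ∫⁻ x in (‖·‖) ⁻¹' B, c x ∂stdGaussian E =
      stdGaussian E ((‖·‖) ⁻¹' B) * ∫⁻ x, c x ∂stdGaussian E := by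
  have key : ∀ (B : Set ℝ), MeasurableSet B → ∀ c : E → ENNReal, Measurable c →
      (∀ r : ℝ, 0 < r → ∀ x, c (r • x) = c x) → ∫⁻ x in (‖·‖) ⁻¹' B, c x ∂stdGaussian E = _ :=
    fun B hB c hc hhom => (setLIntegral_norm_stdGaussian hB hc).trans
      (lintegral_norm_mul_eq ((measurable_gaussianDensity _).indicator hB) hc hhom)
  -- Each integral is an angular factor `A(c)` times a radial factor `R(B)`. The claim `A(c) R(B) =
  -- A(1) R(B) · A(c) R(univ)` follows from the normalisation `A(1) R(univ) = 1`.
  have h1 := key _ .univ (fun _ => 1) measurable_const fun _ _ _ => rfl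
  have h2 := key B hB (fun _ => 1) measurable_const fun _ _ _ => rfl
  have h3 := key _ .univ c hc hhom
  simp only [Set.preimage_univ, Measure.restrict_univ, lintegral_one, measure_univ] at h1 h3
  rw [setLIntegral_one, lintegral_one] at h2
  rw [key B hB c hc hhom, h2, h3]
  refine (one_mul _).symm.trans ?_
  rw [h1]
  ring

/-- The Cameron–Martin formula, from translation invariance of the volume and expansion of `‖x + m‖
^ 2`. -/
theorem map_const_add_stdGaussian (m : E) :
    (stdGaussian E).map (m + ·) =
      (stdGaussian E).withDensity fun x => ENNReal.ofReal (Real.exp (⟪x, m⟫ - ‖m‖ ^ 2 / 2)) := by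
  refine Measure.ext_of_lintegral _ fun f hf => ?_
  rw [lintegral_map hf (by fun_prop), lintegral_withDensity_eq_lintegral_mul _ (by fun_prop) hf,
    stdGaussian_eq_withDensity, lintegral_withDensity_eq_lintegral_mul _ (by fun_prop)
      (by fun_prop), lintegral_withDensity_eq_lintegral_mul _ (by fun_prop) (by fun_prop)]
  conv_rhs => rw [← lintegral_add_left_eq_self _ m]
  refine lintegral_congr fun x => ?_
  simp only [Pi.mul_apply]
  rw [← mul_assoc]
  congr 1
  simp only [gaussianDensity]
  rw [← ENNReal.ofReal_mul (by positivity), mul_assoc, ← Real.exp_add, norm_add_sq_real,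
    inner_add_left, real_inner_self_eq_norm_sq, real_inner_comm]
  congr 3
  ring

/-- A Gaussian vector that is shifted away from a cone is less spread along the rays of the cone
than a centred one. -/
theorem map_const_add_stdGaussian_inter_norm_le {m : E} {S : Set E} (hS : MeasurableSet S)
    (h0 : 0 ∉ S) (hcone : ∀ r : ℝ, 0 < r → ∀ x ∈ S, r • x ∈ S) (hm : ∀ x ∈ S, ⟪x, m⟫ ≤ 0)
    {t : ℝ} (ht : 0 ≤ t) :
    ((stdGaussian E).map (m + ·)).real (S ∩ {x | t < ‖x‖}) ≤
      (stdGaussian E).real {x | t < ‖x‖} * ((stdGaussian E).map (m + ·)).real S := by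
  rcases subsingleton_or_nontrivial E with hE | hE
  · have : S = ∅ := by
      ext x
      simp [Subsingleton.elim x 0, h0]
    simp [this]
  have : IsProbabilityMeasure ((stdGaussian E).map (m + ·)) :=
    Measure.isProbabilityMeasure_map (by fun_prop)
  set ν := (stdGaussian E).map (m + ·) with hν
  set g : E → ENNReal := fun x => ENNReal.ofReal (Real.exp (⟪x, m⟫ - ‖m‖ ^ 2 / 2)) with hg
  have hgm : Measurable g := by fun_prop
  -- On each ray of `S` the likelihood ratio `g` is frozen at its value at radius `t`. The result is
  -- constant on rays, dominates `g` beyond radius `t` and is dominated by it within.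
  set c : E → ENNReal := S.indicator fun x => g ((t / ‖x‖) • x) with hc
  have hcm : Measurable c := Measurable.indicator (by fun_prop) hS
  have hiff : ∀ r : ℝ, 0 < r → ∀ x, r • x ∈ S ↔ x ∈ S := fun r hr x =>
    ⟨fun h => by simpa [inv_smul_smul₀ hr.ne'] using hcone r⁻¹ (inv_pos.2 hr) _ h, hcone r hr x⟩
  have hhom : ∀ r : ℝ, 0 < r → ∀ x, c (r • x) = c x := by
    intro r hr x
    by_cases hx : x ∈ S
    · have hx0 : ‖x‖ ≠ 0 := norm_ne_zero_iff.2 fun h => h0 (h ▸ hx)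
      simp only [hc, Set.indicator_of_mem hx, Set.indicator_of_mem ((hiff r hr x).2 hx)]
      rw [norm_smul, Real.norm_of_nonneg hr.le, smul_smul]
      congr 2
      field_simp
    · simp only [hc, Set.indicator_of_notMem hx, Set.indicator_of_notMem (mt (hiff r hr x).1 hx)]
  have hνS : ∀ B : Set ℝ, MeasurableSet B →
      ν (S ∩ (‖·‖) ⁻¹' B) = ∫⁻ x in (‖·‖) ⁻¹' B, S.indicator g x ∂stdGaussian E := by
    intro B hB
    rw [hν, map_const_add_stdGaussian, withDensity_apply _ (hS.inter (measurable_norm hB)),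
      lintegral_indicator hS, Measure.restrict_restrict hS]
  have hmono : ∀ {a b : ℝ} {x : E}, x ∈ S → a ≤ b → g (b • x) ≤ g (a • x) := by
    intro a b x hx hab
    simp only [hg, inner_smul_left, RCLike.conj_to_real]
    gcongr ENNReal.ofReal (Real.exp (?_ - _))
    exact mul_le_mul_of_nonpos_right hab (hm x hx)
  have hpos : ∀ x ∈ S, 0 < ‖x‖ := fun x hx => norm_pos_iff.2 fun h => h0 (h ▸ hx)
  have hout : ν (S ∩ (‖·‖) ⁻¹' Set.Ioi t) ≤
      stdGaussian E ((‖·‖) ⁻¹' Set.Ioi t) * ∫⁻ x, c x ∂stdGaussian E := by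
    rw [hνS _ measurableSet_Ioi,
      ← setLIntegral_norm_stdGaussian_eq_mul measurableSet_Ioi hcm hhom]
    refine setLIntegral_mono hcm fun x hx => ?_
    by_cases hxS : x ∈ S
    · simp only [hc, Set.indicator_of_mem hxS]
      have := hmono hxS (div_le_one_of_le₀ (le_of_lt hx) (norm_nonneg x))
      rwa [one_smul] at this
    · simp [hc, hxS]
  have hin : stdGaussian E ((‖·‖) ⁻¹' Set.Iic t) * ∫⁻ x, c x ∂stdGaussian E ≤
      ν (S ∩ (‖·‖) ⁻¹' Set.Iic t) := by
    rw [hνS _ measurableSet_Iic,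
      ← setLIntegral_norm_stdGaussian_eq_mul measurableSet_Iic hcm hhom]
    refine setLIntegral_mono (hgm.indicator hS) fun x hx => ?_
    by_cases hxS : x ∈ S
    · simp only [hc, Set.indicator_of_mem hxS]
      have := hmono hxS ((one_le_div (hpos x hxS)).2 hx)
      rwa [one_smul] at this
    · simp [hc, hxS]
  have hJ : ∫⁻ x, c x ∂stdGaussian E ≠ ⊤ := by
    refine ne_top_of_le_ne_top ENNReal.one_ne_top ?_
    calc ∫⁻ x, c x ∂stdGaussian E ≤ ∫⁻ x, 1 ∂stdGaussian E := by
          refine lintegral_mono fun x => ?_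
          by_cases hxS : x ∈ S
          · simp only [hc, Set.indicator_of_mem hxS, hg, ENNReal.ofReal_le_one,
              Real.exp_le_one_iff, inner_smul_left, RCLike.conj_to_real]
            nlinarith [mul_nonpos_of_nonneg_of_nonpos (div_nonneg ht (norm_nonneg x)) (hm x hxS),
              sq_nonneg ‖m‖]
          · simp [hc, hxS]
      _ = 1 := by simp
  set J := (∫⁻ x, c x ∂stdGaussian E).toReal with hJdef
  have hcompl : (‖·‖) ⁻¹' Set.Iic t = ((‖·‖) ⁻¹' Set.Ioi t : Set E)ᶜ := by
    ext x; simp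
  have hmeas : MeasurableSet ((‖·‖) ⁻¹' Set.Ioi t : Set E) := measurable_norm measurableSet_Ioi
  have hout' : ν.real (S ∩ (‖·‖) ⁻¹' Set.Ioi t) ≤
      (stdGaussian E).real ((‖·‖) ⁻¹' Set.Ioi t) * J := by
    rw [measureReal_def, measureReal_def, hJdef, ← ENNReal.toReal_mul]
    exact ENNReal.toReal_mono (ENNReal.mul_ne_top (measure_ne_top _ _) hJ) hout
  have hin' : (stdGaussian E).real ((‖·‖) ⁻¹' Set.Iic t) * J ≤
      ν.real (S ∩ (‖·‖) ⁻¹' Set.Iic t) := by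
    rw [measureReal_def, measureReal_def, hJdef, ← ENNReal.toReal_mul]
    exact ENNReal.toReal_mono (measure_ne_top _ _) hin
  rw [hcompl, probReal_compl_eq_one_sub hmeas, ← Set.sdiff_eq] at hin'
  have hsum := measureReal_inter_add_sdiff (μ := ν) (s := S) hmeas
  have hβ0 : 0 ≤ (stdGaussian E).real ((‖·‖) ⁻¹' Set.Ioi t) := measureReal_nonneg
  have hβ1 : (stdGaussian E).real ((‖·‖) ⁻¹' Set.Ioi t) ≤ 1 := measureReal_le_one
  change ν.real (S ∩ (‖·‖) ⁻¹' Set.Ioi t) ≤ (stdGaussian E).real ((‖·‖) ⁻¹' Set.Ioi t) * ν.real S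
  rw [← hsum]
  -- With `β` the centred tail: `(1 - β) ν(out) ≤ β (1 - β) J ≤ β ν(in)`, then add `β ν(out)`.
  nlinarith

end Density

/-! ### Chi-square quantiles -/

section ChiSq

theorem isProbabilityMeasure_chiSq (r : ℕ) : IsProbabilityMeasure (chiSq r) :=
  Measure.isProbabilityMeasure_map (Measurable.aemeasurable (by fun_prop))

theorem chiSq_eq_map_stdGaussian {E : Type*} [NormedAddCommGroup E] [InnerProductSpace ℝ E]
    [FiniteDimensional ℝ E] [MeasurableSpace E] [BorelSpace E] :
    chiSq (Module.finrank ℝ E) = (stdGaussian E).map (fun x => ‖x‖ ^ 2) := by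
  rw [stdGaussian, Measure.map_map (by fun_prop) (by fun_prop), chiSq]
  congr 1
  ext x
  simp only [Function.comp_apply]
  rw [← (stdOrthonormalBasis ℝ E).sum_sq_inner_left]
  refine Finset.sum_congr rfl fun i _ => ?_
  rw [sum_inner, Finset.sum_eq_single i]
  · simp [inner_smul_left]
  · intro j _ hij
    rw [inner_smul_left, (stdOrthonormalBasis ℝ E).inner_eq_zero hij, mul_zero]
  · simp

theorem chiSq_Iic_of_neg (r : ℕ) {x : ℝ} (hx : x < 0) : (chiSq r).real (Set.Iic x) = 0 := by
  rw [chiSq, map_measureReal_apply (by fun_prop) measurableSet_Iic]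
  convert measureReal_empty
  ext y
  simp only [Set.mem_preimage, Set.mem_Iic, Set.mem_empty_iff_false, iff_false, not_le]
  exact hx.trans_le (Finset.sum_nonneg fun i _ => sq_nonneg _)

theorem chiSqQuantile_nonneg (r : ℕ) {β : ℝ} (hβ : 0 < β) : 0 ≤ chiSqQuantile r β := by
  refine Real.sInf_nonneg fun x hx => ?_
  by_contra h
  have : β ≤ (chiSq r).real (Set.Iic x) := hx
  rw [chiSq_Iic_of_neg r (not_le.1 h)] at this
  linarith

/-- Right continuity of the distribution function carries the bound to the infimum; `β < 1` makes
the set nonempty. -/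
theorem le_chiSq_Iic_chiSqQuantile (r : ℕ) {β : ℝ} (hβ₁ : β < 1) :
    β ≤ (chiSq r).real (Set.Iic (chiSqQuantile r β)) := by
  have := isProbabilityMeasure_chiSq r
  rw [← cdf_eq_real]
  have hne : {x : ℝ | β ≤ (chiSq r).real (Set.Iic x)}.Nonempty := by
    obtain ⟨x, hx⟩ := ((tendsto_cdf_atTop (chiSq r)).eventually (lt_mem_nhds hβ₁)).exists
    exact ⟨x, by rw [Set.mem_ofPred_eq, ← cdf_eq_real]; exact hx.le⟩
  have hcont := ((cdf (chiSq r)).right_continuous (chiSqQuantile r β)).mono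
    (Set.Ioi_subset_Ici_self)
  refine ge_of_tendsto hcont ?_
  filter_upwards [self_mem_nhdsWithin] with x hx
  obtain ⟨y, hy, hyx⟩ := exists_lt_of_csInf_lt hne hx
  have hy' : β ≤ (chiSq r).real (Set.Iic y) := hy
  rw [← cdf_eq_real] at hy'
  exact hy'.trans (monotone_cdf _ hyx.le)

theorem stdGaussian_sqrt_chiSqQuantile_lt_norm_le {E : Type*} [NormedAddCommGroup E]
    [InnerProductSpace ℝ E] [FiniteDimensional ℝ E] [MeasurableSpace E] [BorelSpace E]
    {α : ℝ} (hα₀ : 0 < α) (hα₁ : α < 1) :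
    (stdGaussian E).real {x | √(chiSqQuantile (Module.finrank ℝ E) (1 - α)) < ‖x‖} ≤ α := by
  have h := le_chiSq_Iic_chiSqQuantile (Module.finrank ℝ E) (β := 1 - α)
    (by linarith)
  set q := chiSqQuantile (Module.finrank ℝ E) (1 - α)
  have hset : {x : E | √q < ‖x‖} = ((fun x => ‖x‖ ^ 2) ⁻¹' Set.Iic q)ᶜ := by
    ext x
    simp only [Set.mem_ofPred_eq, Set.mem_compl_iff, Set.mem_preimage, Set.mem_Iic, not_le]
    exact Real.sqrt_lt (chiSqQuantile_nonneg _ (by linarith)) (norm_nonneg x)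
  rw [chiSq_eq_map_stdGaussian, map_measureReal_apply (by fun_prop) measurableSet_Iic] at h
  rw [hset, probReal_compl_eq_one_sub (measurableSet_preimage (by fun_prop) measurableSet_Iic)]
  linarith

end ChiSq

/-! ### Independent projections and the bound on each cell -/

section Projection

variable {E : Type*} [NormedAddCommGroup E] [InnerProductSpace ℝ E] [FiniteDimensional ℝ E]
  [MeasurableSpace E] [BorelSpace E]

theorem map_orthogonalProjectionOnto_stdGaussian (L : Submodule ℝ E) :
    (stdGaussian E).map L.orthogonalProjectionOnto = stdGaussian L := by
  have : IsProbabilityMeasure ((stdGaussian E).map L.orthogonalProjectionOnto) :=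
    Measure.isProbabilityMeasure_map (by fun_prop)
  refine Measure.ext_of_charFun ?_
  ext t
  rw [charFun_stdGaussian, charFun_apply, integral_map (by fun_prop) (by fun_prop)]
  have h := charFun_stdGaussian (E := E) (t : E)
  rw [charFun_apply] at h
  simpa using h

/-- The pair is jointly Gaussian, and its cross-covariances are the inner products of orthogonal
vectors. -/
theorem indepFun_orthogonalProjectionOnto_stdGaussian (L : Submodule ℝ E) :
    IndepFun L.orthogonalProjectionOnto Lᗮ.orthogonalProjectionOnto (stdGaussian E) := by
  have hg : HasGaussianLaw (fun x => (L.orthogonalProjectionOnto x, Lᗮ.orthogonalProjectionOnto x))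
      (stdGaussian E) :=
    (IsGaussian.hasGaussianLaw_id (μ := stdGaussian E)).map
      (L.orthogonalProjectionOnto.prod Lᗮ.orthogonalProjectionOnto)
  refine hg.indepFun_of_covariance_inner fun x y => ?_
  have h := covarianceBilin_apply_eq_cov (μ := stdGaussian E) IsGaussian.memLp_two_id
    (x : E) (y : E)
  rw [covarianceBilin_stdGaussian, innerSL_apply_apply,
    Submodule.inner_right_of_mem_orthogonal x.2 y.2] at h
  simp only [Submodule.inner_orthogonalProjectionOnto_eq_of_mem_left]
  exact h.symm

theorem map_const_add_stdGaussian_projection_inter (L : Submodule ℝ E) (m : E) {S : Set L}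
    (hS : MeasurableSet S) {W : Set Lᗮ} (hW : MeasurableSet W) :
    ((stdGaussian E).map (m + ·)).real
        (L.orthogonalProjectionOnto ⁻¹' S ∩ Lᗮ.orthogonalProjectionOnto ⁻¹' W) =
      ((stdGaussian L).map (L.orthogonalProjectionOnto m + ·)).real S *
        ((stdGaussian Lᗮ).map (Lᗮ.orthogonalProjectionOnto m + ·)).real W := by
  have hm1 : Measurable (L.orthogonalProjectionOnto) := by fun_prop
  have hm2 : Measurable (Lᗮ.orthogonalProjectionOnto) := by fun_prop
  have ha1 := measurable_const_add (L.orthogonalProjectionOnto m)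
  have ha2 := measurable_const_add (Lᗮ.orthogonalProjectionOnto m)
  rw [map_measureReal_apply (by fun_prop) ((hm1 hS).inter (hm2 hW)),
    map_measureReal_apply ha1 hS, map_measureReal_apply ha2 hW,
    ← map_orthogonalProjectionOnto_stdGaussian, ← map_orthogonalProjectionOnto_stdGaussian,
    map_measureReal_apply hm1 (ha1 hS), map_measureReal_apply hm2 (ha2 hW)]
  have h := (indepFun_orthogonalProjectionOnto_stdGaussian L).measure_inter_preimage_eq_mul _ _
    (ha1 hS) (ha2 hW)
  rw [measureReal_def, measureReal_def, measureReal_def, ← ENNReal.toReal_mul, ← h]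
  congr 2
  ext x
  simp

variable {D : Set E} {K : PointedCone ℝ E}

/-- The part of the rejection region in the cell of the face `F`. -/
def faceRejection (D : Set E) (α : ℝ) (F : PointedCone ℝ E) : Set E :=
  {v | v ∈ faceCell D F ∧
    chiSqQuantile (Module.finrank ℝ (Submodule.span ℝ (F : Set E))) (1 - α) <
      ‖(Submodule.span ℝ (F : Set E)).starProjection v‖ ^ 2}

/-- The points of the cell of `F` whose projection onto the span of `F` is not zero. -/
def faceCellNeZero (D : Set E) (F : PointedCone ℝ E) : Set E :=
  {v | v ∈ faceCell D F ∧ (Submodule.span ℝ (F : Set E)).starProjection v ≠ 0}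

theorem measurableSet_faceCell (hD : MeasurableSet D) (F : PointedCone ℝ E) :
    MeasurableSet (faceCell D F) :=
  ((by fun_prop : Measurable (Submodule.span ℝ (F : Set E)).starProjection)
    (measurableSet_intrinsicInterior _)).inter
    ((by fun_prop : Measurable (Submodule.span ℝ (F : Set E))ᗮ.starProjection) hD)

theorem measurableSet_faceRejection (hD : MeasurableSet D) (α : ℝ) (F : PointedCone ℝ E) :
    MeasurableSet (faceRejection D α F) :=
  (measurableSet_faceCell hD F).inter (measurableSet_lt measurable_const
    (by fun_prop : Measurable fun v => ‖(Submodule.span ℝ (F : Set E)).starProjection v‖ ^ 2))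

theorem measurableSet_faceCellNeZero (hD : MeasurableSet D) (F : PointedCone ℝ E) :
    MeasurableSet (faceCellNeZero D F) :=
  (measurableSet_faceCell hD F).inter
    ((by fun_prop : Measurable (Submodule.span ℝ (F : Set E)).starProjection)
      (measurableSet_singleton 0).compl)

/-- Only the factor in `L` sees the critical value. Its mean is the projection of `m`, whose inner
product with `u ∈ ri F` is `⟪u, m⟫ ≤ 0`, so the shifted tail bound applies. -/
theorem measure_faceRejection_le (hD : MeasurableSet D)
    (hK : ∀ x, x ∈ K ↔ ∀ v ∈ D, ⟪x, v⟫ ≤ 0) {F : PointedCone ℝ E} (hF : F ≤ K) {m : E}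
    (hm : m ∈ D) {α : ℝ} (hα₀ : 0 < α) (hα₁ : α < 1) :
    ((stdGaussian E).map (m + ·)).real (faceRejection D α F) ≤
      α * ((stdGaussian E).map (m + ·)).real (faceCellNeZero D F) := by
  set L := Submodule.span ℝ (F : Set E) with hL
  set q := chiSqQuantile (Module.finrank ℝ L) (1 - α) with hq
  have hq0 : 0 ≤ q := chiSqQuantile_nonneg _ (by linarith)
  set S : Set L := {u | (u : E) ∈ intrinsicInterior ℝ (F : Set E) ∧ u ≠ 0} with hSdef
  set W : Set Lᗮ := {w | (w : E) ∈ D} with hWdef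
  have hS : MeasurableSet S :=
    (measurable_subtype_coe (measurableSet_intrinsicInterior _)).inter
      (measurableSet_singleton 0).compl
  have hW : MeasurableSet W := measurable_subtype_coe hD
  have hB : MeasurableSet {u : L | √q < ‖u‖} := measurableSet_lt measurable_const (by fun_prop)
  have h1 : faceRejection D α F = L.orthogonalProjectionOnto ⁻¹' (S ∩ {u | √q < ‖u‖}) ∩
      Lᗮ.orthogonalProjectionOnto ⁻¹' W := by
    ext v
    have hlt : √q < ‖L.orthogonalProjectionOnto v‖ ↔ q < ‖L.starProjection v‖ ^ 2 :=
      Real.sqrt_lt hq0 (norm_nonneg _)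
    have hne : √q < ‖L.orthogonalProjectionOnto v‖ → L.orthogonalProjectionOnto v ≠ 0 :=
      fun h => norm_pos_iff.1 ((Real.sqrt_nonneg q).trans_lt h)
    simp only [faceRejection, faceCell, Set.mem_inter_iff, Set.mem_preimage, Set.mem_ofPred_eq,
      hSdef, hWdef, hlt, Submodule.coe_orthogonalProjectionOnto_apply, ← hL] at hne ⊢
    tauto
  have h2 : faceCellNeZero D F = L.orthogonalProjectionOnto ⁻¹' S ∩
      Lᗮ.orthogonalProjectionOnto ⁻¹' W := by
    ext v
    simp only [faceCellNeZero, faceCell, Set.mem_inter_iff, Set.mem_preimage, Set.mem_ofPred_eq,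
      hSdef, hWdef, Submodule.coe_orthogonalProjectionOnto_apply, ← hL, ne_eq, ← Subtype.coe_inj,
      ZeroMemClass.coe_zero]
    tauto
  rw [h1, h2, map_const_add_stdGaussian_projection_inter _ _ (hS.inter hB) hW,
    map_const_add_stdGaussian_projection_inter _ _ hS hW, ← mul_assoc]
  gcongr
  refine (map_const_add_stdGaussian_inter_norm_le hS (fun h => h.2 rfl) (fun r hr u hu => ⟨?_, ?_⟩)
    (fun u hu => ?_) (Real.sqrt_nonneg q)).trans ?_
  · exact smul_mem_intrinsicInterior_pointedCone hr hu.1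
  · exact smul_ne_zero hr.ne' hu.2
  · rw [Submodule.inner_orthogonalProjectionOnto_eq_of_mem_left]
    exact (hK u).1 (hF (intrinsicInterior_subset hu.1)) m hm
  · gcongr
    exact stdGaussian_sqrt_chiSqQuantile_lt_norm_le hα₀ hα₁

/-- Uniqueness in Moreau's decomposition makes the cells disjoint and gives points of `D` the
projection `0`, which excludes them from every `faceCellNeZero`. -/
theorem measure_iUnion_faceRejection_le [Finite {F : PointedCone ℝ E // F.IsFaceOf K}]
    (hD : MeasurableSet D) (hK : ∀ x, x ∈ K ↔ ∀ v ∈ D, ⟪x, v⟫ ≤ 0) {m : E}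
    (hm : m ∈ D) {α : ℝ} (hα₀ : 0 < α) (hα₁ : α < 1) :
    ((stdGaussian E).map (m + ·)).real
        (⋃ F : {F : PointedCone ℝ E // F.IsFaceOf K}, faceRejection D α F.1) ≤
      (1 - ((stdGaussian E).map (m + ·)).real D) * α := by
  have := Fintype.ofFinite {F : PointedCone ℝ E // F.IsFaceOf K}
  set ν := (stdGaussian E).map (m + ·) with hν
  have : IsProbabilityMeasure ν := Measure.isProbabilityMeasure_map (by fun_prop)
  have hdisj : Pairwise (Function.onFun Disjoint
      fun F : {F : PointedCone ℝ E // F.IsFaceOf K} => faceCellNeZero D F.1) := by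
    intro F G hFG
    refine Set.disjoint_left.2 fun v hvF hvG => hFG (Subtype.ext ?_)
    have hG := moreau_of_mem_faceCell hvG.1
    have h := starProjection_eq_of_mem_faceCell hK F.2.le hvF.1
      (G.2.le (intrinsicInterior_subset hvG.1.1)) hG.1 hG.2
    exact eq_of_mem_intrinsicInterior_of_isFaceOf F.2 G.2 hvF.1.1 (h ▸ hvG.1.1)
  have hsub : (⋃ F : {F : PointedCone ℝ E // F.IsFaceOf K}, faceCellNeZero D F.1) ⊆ Dᶜ := by
    refine Set.iUnion_subset fun F v hv hvD => hv.2 ?_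
    exact starProjection_eq_of_mem_faceCell hK F.2.le hv.1 K.zero_mem (by simpa using hvD)
      (by simp)
  calc ν.real (⋃ F : {F : PointedCone ℝ E // F.IsFaceOf K}, faceRejection D α F.1)
      ≤ ∑ F : {F : PointedCone ℝ E // F.IsFaceOf K}, ν.real (faceRejection D α F.1) :=
        measureReal_iUnion_fintype_le _
    _ ≤ ∑ F : {F : PointedCone ℝ E // F.IsFaceOf K}, α * ν.real (faceCellNeZero D F.1) :=
        Finset.sum_le_sum fun F _ => measure_faceRejection_le hD hK F.2.le hm hα₀ hα₁
    _ = ν.real (⋃ F : {F : PointedCone ℝ E // F.IsFaceOf K}, faceCellNeZero D F.1) * α := by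
        rw [← Finset.mul_sum, mul_comm, measureReal_iUnion_fintype hdisj
          fun F => measurableSet_faceCellNeZero hD F.1]
    _ ≤ ν.real Dᶜ * α := by
        gcongr
        exact measure_ne_top _ _
    _ = _ := by rw [probReal_compl_eq_one_sub hD]

end Projection

/-! ### Transport between the `V`-geometry and the Euclidean one -/

theorem exists_continuousLinearEquiv_innerV {p : ℕ} {V : Matrix (Fin p) (Fin p) ℝ}
    (hV : V.PosDef) :
    ∃ e : EuclideanSpace ℝ (Fin p) ≃L[ℝ] EuclideanSpace ℝ (Fin p),
      (∀ x y, innerV V (e x) (e y) = ⟪x, y⟫) ∧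
      ∀ m, multivariateGaussian (e m) V =
        ((stdGaussian (EuclideanSpace ℝ (Fin p))).map (m + ·)).map e := by
  open scoped MatrixOrder in
  set Q := CFC.sqrt V with hQ
  have hQQ : Q * Q = V := CFC.sqrt_mul_sqrt_self _ hV.posSemidef.nonneg
  have hQT : Q.transpose = Q := by
    have h : IsSelfAdjoint Q := (CFC.sqrt_nonneg V).isSelfAdjoint
    rw [← Matrix.conjTranspose_eq_transpose_of_trivial]
    exact h
  have hdet : IsUnit Q.det := by
    have h := hV.det_pos.ne'
    rw [← hQQ, Matrix.det_mul] at h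
    exact (left_ne_zero_of_mul h).isUnit
  have happ : ∀ x : EuclideanSpace ℝ (Fin p),
      (Matrix.toEuclideanCLM (𝕜 := ℝ) Q x).ofLp = Q.mulVec x.ofLp := fun x => by simp
  let e : EuclideanSpace ℝ (Fin p) ≃L[ℝ] EuclideanSpace ℝ (Fin p) :=
    ContinuousLinearEquiv.equivOfInverse (Matrix.toEuclideanCLM (𝕜 := ℝ) Q)
      (Matrix.toEuclideanCLM (𝕜 := ℝ) Q⁻¹)
      (fun x => by
        rw [← ContinuousLinearMap.comp_apply, ← ContinuousLinearMap.mul_def, ← map_mul,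
          Matrix.nonsing_inv_mul _ hdet, map_one, one_apply_eq_self])
      (fun x => by
        rw [← ContinuousLinearMap.comp_apply, ← ContinuousLinearMap.mul_def, ← map_mul,
          Matrix.mul_nonsing_inv _ hdet, map_one, one_apply_eq_self])
  have he : ∀ x, e x = Matrix.toEuclideanCLM (𝕜 := ℝ) Q x := fun x => rfl
  refine ⟨e, fun x y => ?_, fun m => ?_⟩
  · have hV' : V⁻¹ = Q⁻¹ * Q⁻¹ := by rw [← hQQ, Matrix.mul_inv_rev]
    rw [innerV, he, he, happ, happ, Matrix.mulVec_mulVec, hV', mul_assoc,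
      Matrix.nonsing_inv_mul _ hdet, mul_one, Matrix.dotProduct_mulVec, ← Matrix.mulVec_transpose,
      Matrix.mulVec_mulVec, Matrix.transpose_nonsing_inv, hQT, Matrix.nonsing_inv_mul _ hdet,
      Matrix.one_mulVec, EuclideanSpace.inner_eq_star_dotProduct, dotProduct_comm]
    simp
  · rw [multivariateGaussian, Measure.map_map (by fun_prop) (by fun_prop)]
    congr 1
    ext1 x
    simp [he, ← hQ]

section Transport

variable {p : ℕ} {V : Matrix (Fin p) (Fin p) ℝ} {C : Set (EuclideanSpace ℝ (Fin p))}
  {e : EuclideanSpace ℝ (Fin p) ≃L[ℝ] EuclideanSpace ℝ (Fin p)}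

theorem normSqV_apply (he : ∀ x y, innerV V (e x) (e y) = ⟪x, y⟫)
    (x : EuclideanSpace ℝ (Fin p)) : normSqV V (e x) = ‖x‖ ^ 2 := by
  rw [normSqV, he, real_inner_self_eq_norm_sq]

theorem exists_preimage_eq_setOf_inner (hC : IsPolyhedralCone C)
    (e : EuclideanSpace ℝ (Fin p) ≃L[ℝ] EuclideanSpace ℝ (Fin p)) :
    ∃ (k : ℕ) (b : Fin k → EuclideanSpace ℝ (Fin p)), e ⁻¹' C = {v | ∀ j, 0 ≤ ⟪b j, v⟫} := by
  obtain ⟨k, A, rfl⟩ := hC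
  refine ⟨k, fun j => (e : _ →L[ℝ] _).adjoint (WithLp.toLp 2 (A j)), ?_⟩
  ext v
  simp only [Set.mem_preimage, Set.mem_ofPred_eq, ContinuousLinearMap.adjoint_inner_left]
  refine forall_congr' fun j => ?_
  rw [EuclideanSpace.inner_eq_star_dotProduct, dotProduct_comm]
  simp [Matrix.mulVec]

theorem mem_comap_polarCone_iff (he : ∀ x y, innerV V (e x) (e y) = ⟪x, y⟫)
    (x : EuclideanSpace ℝ (Fin p)) :
    x ∈ (polarCone V C).comap (e : EuclideanSpace ℝ (Fin p) →ₗ[ℝ] EuclideanSpace ℝ (Fin p)) ↔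
      ∀ v ∈ e ⁻¹' C, ⟪x, v⟫ ≤ 0 := by
  rw [PointedCone.mem_comap]
  constructor
  · intro h v hv
    rw [← he]
    exact h _ hv
  · intro h θ hθ
    have := h (e.symm θ) (by simpa using hθ)
    rwa [← he, e.apply_symm_apply] at this

theorem mem_intrinsicInterior_comap_iff {F : PointedCone ℝ (EuclideanSpace ℝ (Fin p))}
    (e : EuclideanSpace ℝ (Fin p) ≃L[ℝ] EuclideanSpace ℝ (Fin p)) {x : EuclideanSpace ℝ (Fin p)} :
    x ∈ intrinsicInterior ℝ (F.comap
      (e : EuclideanSpace ℝ (Fin p) →ₗ[ℝ] EuclideanSpace ℝ (Fin p)) : Set _) ↔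
      e x ∈ intrinsicInterior ℝ (F : Set (EuclideanSpace ℝ (Fin p))) := by
  simp only [mem_intrinsicInterior_pointedCone_iff, PointedCone.mem_comap]
  refine and_congr Iff.rfl ⟨fun h y hy => ?_, fun h y hy => ?_⟩
  · simpa using h (e.symm y) (by simpa using hy)
  · simpa using h (e y) hy

theorem spanRank_comap (F : PointedCone ℝ (EuclideanSpace ℝ (Fin p)))
    (e : EuclideanSpace ℝ (Fin p) ≃L[ℝ] EuclideanSpace ℝ (Fin p)) :
    spanRank (F.comap (e : EuclideanSpace ℝ (Fin p) →ₗ[ℝ] EuclideanSpace ℝ (Fin p))) =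
      spanRank F := by
  have h : Submodule.span ℝ (F : Set (EuclideanSpace ℝ (Fin p))) = (Submodule.span ℝ (F.comap
      (e : EuclideanSpace ℝ (Fin p) →ₗ[ℝ] EuclideanSpace ℝ (Fin p)) : Set _)).map
      (e.toLinearEquiv : EuclideanSpace ℝ (Fin p) →ₗ[ℝ] EuclideanSpace ℝ (Fin p)) := by
    rw [Submodule.map_span]
    congr 1
    exact (Set.image_preimage_eq (F : Set _) e.surjective).symm
  rw [spanRank, spanRank, h, LinearEquiv.finrank_map_eq]

/-- By Farkas' lemma the polar cone is generated by the vectors `-b j`. -/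
theorem finite_isFaceOf_of_polar {ι E : Type*} [Finite ι] [NormedAddCommGroup E]
    [InnerProductSpace ℝ E] [FiniteDimensional ℝ E] {b : ι → E} {K : PointedCone ℝ E}
    (hK : ∀ x, x ∈ K ↔ ∀ v ∈ {v | ∀ j, 0 ≤ ⟪b j, v⟫}, ⟪x, v⟫ ≤ 0) :
    Finite {F : PointedCone ℝ E // F.IsFaceOf K} := by
  have := Fintype.ofFinite ι
  refine finite_isFaceOf K (fun j => -b j) (fun j => ?_) fun x hx => ?_
  · refine (hK _).2 fun v hv => ?_
    simpa using hv j
  · refine exists_nonneg_combination_of_forall_inner_nonneg _ x fun y hy => ?_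
    have := (hK x).1 hx (-y) fun j => by simpa using hy j
    simpa using this

theorem projV_eq_of_moreau (he : ∀ x y, innerV V (e x) (e y) = ⟪x, y⟫)
    {v z : EuclideanSpace ℝ (Fin p)} (hz : e z ∈ polarCone V C) (hw : e (v - z) ∈ C)
    (h0 : ⟪z, v - z⟫ = 0) : projV V (polarCone V C) (e v) = e z := by
  have hle : ∀ w ∈ polarCone V C,
      normSqV V (e v - e z) + ‖z - e.symm w‖ ^ 2 ≤ normSqV V (e v - w) := by
    intro w hw'
    have h := norm_sub_sq_le_of_moreau (mem_comap_polarCone_iff he) hw h0 (x := e.symm w)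
      (by simpa [PointedCone.mem_comap] using hw')
    rw [← normSqV_apply he (v - z), ← normSqV_apply he (v - _)] at h
    simpa using h
  have hproj : IsProjV V (polarCone V C) (e v) (e z) :=
    ⟨hz, fun w hw' => by nlinarith [hle w hw', sq_nonneg ‖z - e.symm w‖]⟩
  -- The chosen point is some minimiser, since one exists; the square in `hle` then forces it to be
  -- `e z`.
  have hs : IsProjV V (polarCone V C) (e v) (projV V (polarCone V C) (e v)) :=
    Classical.epsilon_spec (p := IsProjV V (polarCone V C) (e v)) ⟨_, hproj⟩
  have h1 := hle _ hs.1
  have h2 := hs.2 _ hz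
  have h3 : z - e.symm (projV V (polarCone V C) (e v)) = 0 := by
    rw [← norm_eq_zero, ← pow_eq_zero_iff two_ne_zero]
    exact le_antisymm (by linarith) (sq_nonneg _)
  rw [sub_eq_zero.1 h3, e.apply_symm_apply]

theorem LR_eq_of_moreau (he : ∀ x y, innerV V (e x) (e y) = ⟪x, y⟫)
    {v z : EuclideanSpace ℝ (Fin p)} (hz : e z ∈ polarCone V C) (hw : e (v - z) ∈ C)
    (h0 : ⟪z, v - z⟫ = 0) : LR V C (e v) = ‖z‖ ^ 2 := by
  refine IsLeast.csInf_eq ⟨⟨_, hw, ?_⟩, ?_⟩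
  · dsimp only
    rw [← map_sub, normSqV_apply he, sub_sub_cancel]
  · rintro _ ⟨θ, hθ, rfl⟩
    have h := norm_sub_sq_ge_of_moreau (mem_comap_polarCone_iff he) (v := v) hz h0
      (θ := e.symm θ) (by simpa using hθ)
    rw [← normSqV_apply he (v - _)] at h
    simpa using h

theorem critValue_eq {α : ℝ} {y : EuclideanSpace ℝ (Fin p)}
    {F : PointedCone ℝ (EuclideanSpace ℝ (Fin p))} (hF : F.IsFaceOf (polarCone V C))
    (hy : projV V (polarCone V C) y ∈ intrinsicInterior ℝ (F : Set (EuclideanSpace ℝ (Fin p)))) :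
    critValue V C α y = chiSqQuantile (spanRank F) (1 - α) := by
  rw [critValue, finsum_eq_single _ ⟨F, hF⟩, Set.indicator_of_mem hy]
  intro G hG
  refine Set.indicator_of_notMem (fun h => hG (Subtype.ext ?_)) _
  exact eq_of_mem_intrinsicInterior_of_isFaceOf G.2 hF h hy

/-- Turns the test into a finite union of product events, which yields both measurability and the
level. -/
theorem preimage_rejectionRegion (hC : IsPolyhedralCone C)
    (he : ∀ x y, innerV V (e x) (e y) = ⟪x, y⟫) (α : ℝ) :
    e ⁻¹' rejectionRegion V C α =
      ⋃ F : {F : PointedCone ℝ (EuclideanSpace ℝ (Fin p)) // F.IsFaceOf ((polarCone V C).comap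
        (e : EuclideanSpace ℝ (Fin p) →ₗ[ℝ] EuclideanSpace ℝ (Fin p)))},
        faceRejection (e ⁻¹' C) α F.1 := by
  obtain ⟨k, b, hD⟩ := exists_preimage_eq_setOf_inner hC e
  have hK := mem_comap_polarCone_iff (C := C) he
  ext v
  obtain ⟨z, hz, hw, h0⟩ := exists_moreau_decomposition hD hK v
  obtain ⟨F, hF, hzF⟩ := exists_isFaceOf_mem_intrinsicInterior (polarCone V C)
    (z := e z) hz
  have hF' := hF.comap (e : EuclideanSpace ℝ (Fin p) →ₗ[ℝ] EuclideanSpace ℝ (Fin p))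
  have hzF' := (mem_intrinsicInterior_comap_iff e).2 hzF
  have hcell := mem_faceCell_of_moreau hK hF'.le hzF' hw h0
  have hrej : v ∈ e ⁻¹' rejectionRegion V C α ↔
      chiSqQuantile (spanRank F) (1 - α) < ‖z‖ ^ 2 := by
    rw [Set.mem_preimage, rejectionRegion, Set.mem_ofPred_eq, LR_eq_of_moreau he hz hw h0,
      critValue_eq hF (by rwa [projV_eq_of_moreau he hz hw h0])]
  rw [hrej, Set.mem_iUnion, ← spanRank_comap F e]
  constructor
  · intro h
    refine ⟨⟨_, hF'⟩, hcell.1, ?_⟩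
    rw [hcell.2]
    exact h
  · rintro ⟨G, hv, h⟩
    have hG := starProjection_eq_of_mem_faceCell hK G.2.le hv hz hw h0
    rw [hG] at h
    have hzG := hv.1
    rw [hG] at hzG
    rwa [← eq_of_mem_intrinsicInterior_of_isFaceOf G.2 hF' hzG hzF']

end Transport

end TypeBTest

/-! ### The level of the test -/

theorem proposition1 {p : ℕ} (V : Matrix (Fin p) (Fin p) ℝ) (hV : V.PosDef)
    (C : Set (EuclideanSpace ℝ (Fin p))) (hC : TypeBTest.IsPolyhedralCone C)
    (α : ℝ) (hα₀ : 0 < α) (hα₁ : α < 1) :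
    MeasurableSet (TypeBTest.rejectionRegion V C α) ∧
    ∀ μ ∈ C, ∀ {Ω : Type*} [MeasurableSpace Ω] (P : Measure Ω)
      (Y : Ω → EuclideanSpace ℝ (Fin p)), HasLaw Y (multivariateGaussian μ V) P →
      P.real {ω | Y ω ∈ TypeBTest.rejectionRegion V C α} ≤ α ∧
      P.real {ω | Y ω ∈ TypeBTest.rejectionRegion V C α} ≤
        (1 - P.real {ω | Y ω ∈ C}) * α := by
  obtain ⟨e, he, hlaw⟩ := TypeBTest.exists_continuousLinearEquiv_innerV hV
  obtain ⟨k, b, hD⟩ := TypeBTest.exists_preimage_eq_setOf_inner hC e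
  have hK := TypeBTest.mem_comap_polarCone_iff (C := C) he
  have hpre := TypeBTest.preimage_rejectionRegion hC he α
  have hfin := TypeBTest.finite_isFaceOf_of_polar (b := b) (by rwa [hD] at hK)
  have hDm : MeasurableSet (e ⁻¹' C) := by
    rw [hD]
    simp only [Set.ofPred_forall]
    exact MeasurableSet.iInter fun j => measurableSet_le measurable_const (by fun_prop)
  have hem : MeasurableEmbedding e := e.toHomeomorph.measurableEmbedding
  have hC' : MeasurableSet C :=
    e.toHomeomorph.toMeasurableEquiv.measurableSet_preimage.1 hDm
  have hR : MeasurableSet (TypeBTest.rejectionRegion V C α) := by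
    refine e.toHomeomorph.toMeasurableEquiv.measurableSet_preimage.1 ?_
    change MeasurableSet (e ⁻¹' TypeBTest.rejectionRegion V C α)
    rw [hpre]
    exact MeasurableSet.iUnion fun F => TypeBTest.measurableSet_faceRejection hDm α F.1
  refine ⟨hR, fun μ hμ Ω _ P Y hY => ?_⟩
  have hlawY : ∀ s, MeasurableSet s → P.real {ω | Y ω ∈ s} =
      ((stdGaussian (EuclideanSpace ℝ (Fin p))).map (e.symm μ + ·)).real (e ⁻¹' s) := by
    intro s hs
    have h := hlaw (e.symm μ)
    rw [e.apply_symm_apply] at h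
    rw [← map_measureReal_apply hem.measurable hs, ← h, ← hY.map_eq, measureReal_def,
      measureReal_def, Measure.map_apply_of_aemeasurable hY.aemeasurable hs]
    rfl
  have key : P.real {ω | Y ω ∈ TypeBTest.rejectionRegion V C α} ≤
      (1 - P.real {ω | Y ω ∈ C}) * α := by
    rw [hlawY _ hR, hlawY _ hC', hpre]
    exact TypeBTest.measure_iUnion_faceRejection_le hDm hK (by simpa using hμ) hα₀ hα₁
  refine ⟨key.trans ?_, key⟩
  have : 0 ≤ P.real {ω | Y ω ∈ C} := measureReal_nonneg
  nlinarith
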